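/- A group $G$ is called directly indecomposable if $G \cong H \times K$ implies $H = 1$ or $K = 1$. For a finitely generated torsion-free nilpotent group $N$, the rational Malcev completion $N^{\mathbb{Q}}$ is the (up to isomorphism unique) torsion-free nilpotent group such that (1) $N$ embeds into $N^{\mathbb{Q}}$; (2) for all $n \in N$ and all integers $k \geq 1$ there is a unique $m \in N^{\mathbb{Q}}$ with $m^{k} = n$; (3) for every $m \in N^{\mathbb{Q}}$ there is an integer $k \geq 1$ with $m^{k} \in N$. The group $N$ is called rationally indecomposable if $N^{\mathbb{Q}}$ is directly indecomposable. Let $N$ be a finitely generated torsion-free nilpotent group. Then $N$ is rationally indecomposable if and only if every finite-index subgroup of $N$ is directly indecomposable. In particular, if $N$ is rationally indecomposable, then every finite-index subgroup of $N$ is rationally indecomposable. -/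

import Mathlib

universe u v

/-- A group is torsion-free if its only element of finite order is the identity. -/
def TorsionFreeGroup (G : Type u) [Group G] : Prop :=
  ∀ g : G, IsOfFinOrder g → g = 1

/-- `G` is directly indecomposable if `G ≅ H × K` implies `H = 1` or `K = 1`
(so the trivial group counts as directly indecomposable). Since `H` and `K` embed in `G`,
it suffices to let them range over the universe of `G`. -/
def DirectlyIndecomposable (G : Type u) [Group G] : Prop :=
  ∀ (H K : Type u) [Group H] [Group K],
    Nonempty (G ≃* H × K) → Subsingleton H ∨ Subsingleton K

/-- `ι : N →* M` exhibits the torsion-free nilpotent group `M` as the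
rational Malcev completion of `N`. -/
structure IsRationalCompletion {N : Type u} {M : Type v} [Group N] [Group M]
    (ι : N →* M) : Prop where
  torsionFree : TorsionFreeGroup M
  nilpotent : Group.IsNilpotent M
  injective : Function.Injective ι
  existsUnique_root : ∀ (n : N) (k : ℕ), 0 < k → ∃! m : M, m ^ k = ι n
  exists_pow_mem : ∀ m : M, ∃ k : ℕ, 0 < k ∧ m ^ k ∈ ι.range

/-- `N` is rationally indecomposable if its rational Malcev completion exists and is directly
indecomposable. The completion is unique up to isomorphism, so it does not matter which group
with the defining properties is taken. -/
def RationallyIndecomposable (N : Type u) [Group N] : Prop :=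
  ∃ (M : Type u) (_ : Group M) (ι : N →* M),
    IsRationalCompletion ι ∧ DirectlyIndecomposable M

/-! Direct decompositions pass between `N` and its completion `M` up to finite index. A finite-index
subgroup has the same completion `M`, so it suffices to split `M` when `N = A × B`: the elements of
`M` with a positive power in `A`, resp. in `B`, form commuting subgroups (isolators) with product
`M`, by uniqueness of roots. Conversely, if `M = A × B`, the product of `N ∩ A` and `N ∩ B` is
direct and contains a positive power of every element of `N`. Hence it has finite index in `N`, and
if one factor is trivial, so is the corresponding factor of `M`, by torsion-freeness.

The completion has to be constructed. `N` is residually a `p`-group for every prime `p`, and in a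
`p`-group `k`-th roots exist uniquely once `p > k`. So `N` embeds in a product of its `p`-quotients,
over all `p`, modulo what happens at finitely many primes. There all power maps are bijective, and
the isolator of `N` is the completion. -/

open scoped commutatorElement

/-! ### Commutator identities with central elements -/

section CentralCommutator

variable {G : Type*} [Group G] {a b c : G}

theorem pow_mul_eq_of_mul_eq_central (hc : c ∈ Subgroup.center G) (h : a * b = c * b * a) (n : ℕ) :
    a ^ n * b = c ^ n * b * a ^ n := by
  have hc' := Subgroup.mem_center_iff.1 hc
  induction n with
  | zero => simp
  | succ n ih =>
    calc a ^ (n + 1) * b = a ^ n * (a * b) := by rw [pow_succ, mul_assoc]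
      _ = (a ^ n * c) * b * a := by rw [h]; group
      _ = c * (a ^ n * b) * a := by rw [hc']; group
      _ = c ^ (n + 1) * b * a ^ (n + 1) := by rw [ih, pow_succ' c, pow_succ a]; group

theorem mul_pow_eq_of_mul_eq_central (hc : c ∈ Subgroup.center G) (h : a * b = c * b * a) (n : ℕ) :
    a * b ^ n = c ^ n * b ^ n * a := by
  have hc' := Subgroup.mem_center_iff.1 hc
  induction n with
  | zero => simp
  | succ n ih =>
    calc a * b ^ (n + 1) = (a * b ^ n) * b := by rw [pow_succ, mul_assoc]
      _ = c ^ n * b ^ n * (a * b) := by rw [ih]; group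
      _ = c ^ n * (b ^ n * c) * b * a := by rw [h]; group
      _ = c ^ (n + 1) * b ^ (n + 1) * a := by rw [hc', pow_succ c, pow_succ b]; group

/-- With `c = ⁅a, b⁆`, this is bilinearity of a central commutator. -/
theorem pow_mul_pow_eq_of_mul_eq_central (hc : c ∈ Subgroup.center G) (h : a * b = c * b * a)
    (m n : ℕ) : a ^ m * b ^ n = c ^ (m * n) * b ^ n * a ^ m := by
  rw [pow_mul]
  exact mul_pow_eq_of_mul_eq_central (pow_mem hc m) (pow_mul_eq_of_mul_eq_central hc h m) n

theorem commutatorElement_mul_mul_of_mem_center {z y : G} (hz : z ∈ Subgroup.center G)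
    (hy : y ∈ Subgroup.center G) : ⁅a * z, b * y⁆ = ⁅a, b⁆ := by
  have hz' := Subgroup.mem_center_iff.1 hz
  have hy' := Subgroup.mem_center_iff.1 hy
  have e1 : a * z * (b * y) = a * b * (z * y) := by
    rw [mul_assoc, ← mul_assoc z, ← hz' b]; group
  have e2 : (a * z)⁻¹ * (b * y)⁻¹ = (z * y)⁻¹ * (a⁻¹ * b⁻¹) := by
    rw [← mul_inv_rev, ← mul_inv_rev, ← mul_inv_rev, mul_assoc b, ← mul_assoc y, ← hy' a,
      mul_assoc a, ← mul_assoc b, hy' z]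
  rw [commutatorElement_def, mul_assoc, e1, e2]; group

end CentralCommutator

/-! ### Isolators in nilpotent groups -/

/-- A product of commuting elements having a positive power in `A` has a positive power in `A`. -/
theorem Commute.exists_pow_mul_mem {G : Type*} [Group G] {A : Subgroup G} {x y : G}
    (h : Commute x y) (hx : ∃ k : ℕ, 0 < k ∧ x ^ k ∈ A) (hy : ∃ k : ℕ, 0 < k ∧ y ^ k ∈ A) :
    ∃ k : ℕ, 0 < k ∧ (x * y) ^ k ∈ A := by
  obtain ⟨k, hk, hx⟩ := hx
  obtain ⟨l, hl, hy⟩ := hy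
  refine ⟨k * l, Nat.mul_pos hk hl, ?_⟩
  rw [h.mul_pow]
  refine mul_mem ?_ ?_
  · rw [pow_mul]; exact pow_mem hx l
  · rw [mul_comm, pow_mul]; exact pow_mem hy k

theorem exists_pow_inv_mem {G : Type*} [Group G] {A : Subgroup G} {x : G}
    (hx : ∃ k : ℕ, 0 < k ∧ x ^ k ∈ A) : ∃ k : ℕ, 0 < k ∧ x⁻¹ ^ k ∈ A := by
  obtain ⟨k, hk, hx⟩ := hx
  exact ⟨k, hk, by rw [inv_pow]; exact inv_mem hx⟩

/-- Induction on the class. The last nontrivial term `Z` is central, and the claim holds modulo `Z`.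
Generators `⁅w, x⁆` of `Z` are then handled by bilinearity: if `w ^ k` and `x ^ l` agree with `a, b
∈ A` modulo `Z`, then `⁅w, x⁆ ^ (k * l) = ⁅a, b⁆ ∈ A`. -/
theorem exists_pow_mem_of_lowerCentralSeries_eq_bot (n : ℕ) :
    ∀ {G : Type u} [Group G], (⊤ : Subgroup G).lowerCentralSeries (n + 1) = ⊥ →
      ∀ (A : Subgroup G) (S : Set G), Subgroup.closure S = ⊤ →
        (∀ s ∈ S, ∃ k : ℕ, 0 < k ∧ s ^ k ∈ A) → ∀ g : G, ∃ k : ℕ, 0 < k ∧ g ^ k ∈ A := by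
  induction n with
  | zero =>
    intro G _ hG A S hS hSA g
    have hcomm : ∀ x y : G, Commute x y := by
      intro x y
      have : ⁅x, y⁆ ∈ (⊤ : Subgroup G).lowerCentralSeries 1 := by
        rw [Subgroup.top_lowerCentralSeries_one]
        exact Subgroup.commutator_mem_commutator trivial trivial
      rw [hG, Subgroup.mem_bot, commutatorElement_eq_one_iff_commute] at this
      exact this
    have hg : g ∈ Subgroup.closure S := hS ▸ trivial
    induction hg using Subgroup.closure_induction with
    | mem x hx => exact hSA x hx
    | one => exact ⟨1, one_pos, by simp⟩
    | mul x y _ _ hx hy => exact (hcomm x y).exists_pow_mul_mem hx hy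
    | inv x _ hx => exact exists_pow_inv_mem hx
  | succ n ih =>
    intro G _ hG A S hS hSA g
    set Z := (⊤ : Subgroup G).lowerCentralSeries (n + 1) with hZ
    have hZc : ∀ z ∈ Z, z ∈ Subgroup.center G := by
      intro z hz
      rw [Subgroup.mem_center_iff]
      intro y
      have : ⁅z, y⁆ ∈ (⊤ : Subgroup G).lowerCentralSeries (n + 1 + 1) := by
        rw [Subgroup.lowerCentralSeries_succ]
        exact Subgroup.commutator_mem_commutator hz trivial
      rw [hG, Subgroup.mem_bot, commutatorElement_eq_one_iff_commute] at this
      exact this.eq.symm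
    let π := QuotientGroup.mk' Z
    have hπ : Function.Surjective π := QuotientGroup.mk'_surjective Z
    have hquot : ∀ x : G, ∃ k : ℕ, 0 < k ∧ ∃ a ∈ A, ∃ z ∈ Z, x ^ k = a * z := by
      intro x
      obtain ⟨k, hk, hkx⟩ := ih (G := G ⧸ Z) (by
        rw [← Subgroup.map_top_of_surjective π hπ, ← Subgroup.map_lowerCentralSeries,
          Subgroup.map_eq_bot_iff, QuotientGroup.ker_mk']) (A.map π) (π '' S) (by
          rw [← MonoidHom.map_closure, hS, Subgroup.map_top_of_surjective π hπ]) (by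
          rintro _ ⟨s, hs, rfl⟩
          obtain ⟨k, hk, h⟩ := hSA s hs
          exact ⟨k, hk, by rw [← map_pow]; exact Subgroup.mem_map_of_mem _ h⟩) (π x)
      obtain ⟨a, ha, hax⟩ := hkx
      refine ⟨k, hk, a, ha, a⁻¹ * x ^ k, ?_, by group⟩
      rw [← map_pow] at hax
      exact QuotientGroup.eq.1 hax
    have hZA : ∀ z ∈ Z, ∃ k : ℕ, 0 < k ∧ z ^ k ∈ A := by
      intro z hz
      have hz' := hz
      rw [hZ, Subgroup.lowerCentralSeries_succ, Subgroup.commutator_def] at hz'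
      have hmem : ∀ w ∈ {g | ∃ g₁ ∈ (⊤ : Subgroup G).lowerCentralSeries n,
          ∃ g₂ ∈ (⊤ : Subgroup G), ⁅g₁, g₂⁆ = g}, w ∈ Z := by
        rintro _ ⟨w, hw, x, hx, rfl⟩
        rw [hZ, Subgroup.lowerCentralSeries_succ]
        exact Subgroup.commutator_mem_commutator hw hx
      clear hz
      induction hz' using Subgroup.closure_induction with
      | mem c hc =>
        have hcZ := hZc _ (hmem c hc)
        obtain ⟨w, -, x, -, rfl⟩ := hc
        obtain ⟨k, hk, a, ha, z, hz, hw⟩ := hquot w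
        obtain ⟨l, hl, b, hb, y, hy, hx⟩ := hquot x
        refine ⟨k * l, Nat.mul_pos hk hl, ?_⟩
        have h := pow_mul_pow_eq_of_mul_eq_central (a := w) (b := x) hcZ
          (by simp [commutatorElement_def]) k l
        have : ⁅w, x⁆ ^ (k * l) = ⁅a, b⁆ := by
          rw [← commutatorElement_mul_mul_of_mem_center (a := a) (b := b) (hZc z hz) (hZc y hy),
            ← hw, ← hx, commutatorElement_def (w ^ k), h]; group
        rw [this]
        exact mul_mem (mul_mem (mul_mem ha hb) (inv_mem ha)) (inv_mem hb)
      | one => exact ⟨1, one_pos, by simp⟩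
      | mul x y hx hy ihx ihy =>
        refine Commute.exists_pow_mul_mem ?_ ihx ihy
        exact ((Subgroup.mem_center_iff.1 (hZc x ((Subgroup.closure_le _).2 hmem hx))) y).symm
      | inv x _ hx => exact exists_pow_inv_mem hx
    obtain ⟨k, hk, a, ha, z, hz, hgk⟩ := hquot g
    have : Commute a z := (Subgroup.mem_center_iff.1 (hZc z hz)) a
    obtain ⟨l, hl, h⟩ := this.exists_pow_mul_mem ⟨1, one_pos, by simpa using ha⟩ (hZA z hz)
    exact ⟨k * l, Nat.mul_pos hk hl, by rwa [pow_mul, hgk]⟩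

/-- In a nilpotent group generated by elements having a positive power in a subgroup `A`, every
element has a positive power in `A`. -/
theorem exists_pow_mem_of_closure_eq_top {G : Type u} [Group G] [Group.IsNilpotent G]
    (A : Subgroup G) {S : Set G} (hS : Subgroup.closure S = ⊤)
    (hSA : ∀ s ∈ S, ∃ k : ℕ, 0 < k ∧ s ^ k ∈ A) (g : G) : ∃ k : ℕ, 0 < k ∧ g ^ k ∈ A := by
  obtain ⟨n, hn⟩ := Subgroup.nilpotent_iff_lowerCentralSeries.1 ‹Group.IsNilpotent G›
  refine exists_pow_mem_of_lowerCentralSeries_eq_bot n ?_ A S hS hSA g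
  exact le_bot_iff.1 (hn ▸ Subgroup.lowerCentralSeries_antitone _ n.le_succ)

/-- The isolator of a subgroup `A` of a nilpotent group: the elements having a positive power
in `A`. -/
def Subgroup.isolator {G : Type u} [Group G] [Group.IsNilpotent G] (A : Subgroup G) :
    Subgroup G where
  carrier := {x | ∃ k : ℕ, 0 < k ∧ x ^ k ∈ A}
  one_mem' := ⟨1, one_pos, by simp⟩
  inv_mem' := exists_pow_inv_mem
  mul_mem' {x y} hx hy := by
    -- The criterion needs generators of the whole ambient group, so it is applied inside `⟨x, y⟩`.
    let G₀ := Subgroup.closure ({x, y} : Set G)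
    have hx₀ : x ∈ G₀ := Subgroup.subset_closure (by simp)
    have hy₀ : y ∈ G₀ := Subgroup.subset_closure (by simp)
    obtain ⟨k, hk, h⟩ := exists_pow_mem_of_closure_eq_top (A.subgroupOf G₀)
      (Subgroup.closure_closure_coe_preimage (k := ({x, y} : Set G))) (by
        rintro ⟨s, hs⟩ (h | h) <;> obtain rfl : s = _ := h
        · exact hx
        · exact hy) (⟨x, hx₀⟩ * ⟨y, hy₀⟩)
    exact ⟨k, hk, h⟩

theorem Subgroup.le_isolator {G : Type u} [Group G] [Group.IsNilpotent G] (A : Subgroup G) :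
    A ≤ A.isolator :=
  fun x hx => ⟨1, one_pos, by simpa using hx⟩

/-! ### Finite index from powers -/

theorem finiteIndex_of_commutator_le_of_exists_pow_mem {G : Type*} [Group G] [Group.FG G]
    {L : Subgroup G} (hc : commutator G ≤ L) (h : ∀ g : G, ∃ k : ℕ, 0 < k ∧ g ^ k ∈ L) :
    L.FiniteIndex := by
  have : L.Normal := .of_commutator_le _ hc
  have hcomm : IsMulCommutative (G ⧸ L) :=
    Subgroup.Normal.quotient_commutative_iff_commutator_le.2 hc
  let _ : CommGroup (G ⧸ L) := { mul_comm := hcomm.is_comm.comm }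
  rw [Subgroup.finiteIndex_iff_finite_quotient]
  refine CommGroup.finite_of_fg_isMulTorsion _ ?_
  intro x
  induction x using QuotientGroup.induction_on with
  | H g =>
    obtain ⟨k, hk, hg⟩ := h g
    refine isOfFinOrder_iff_pow_eq_one.2 ⟨k, hk, ?_⟩
    rw [← QuotientGroup.mk_pow]
    exact (QuotientGroup.eq_one_iff _).2 hg

/-- A subgroup of a finitely generated nilpotent group containing a positive power of every element
has finite index. -/
theorem finiteIndex_of_exists_pow_mem {G : Type*} [Group G] [Group.FG G] [Group.IsNilpotent G]
    (H : Subgroup G) (h : ∀ g : G, ∃ k : ℕ, 0 < k ∧ g ^ k ∈ H) : H.FiniteIndex := by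
  -- Descend the lower central series. As `Z` is central modulo `Z'`, commutators of `K = H Z` lie
  -- in `H Z'`; `K` is finitely generated by the inductive finite index, so `K / H Z'` is finitely
  -- generated abelian torsion.
  have key : ∀ i : ℕ, (H ⊔ (⊤ : Subgroup G).lowerCentralSeries i).FiniteIndex := by
    intro i
    induction i with
    | zero => rw [Subgroup.lowerCentralSeries_zero, sup_top_eq]; infer_instance
    | succ i ih =>
      set Z := (⊤ : Subgroup G).lowerCentralSeries i
      set Z' := (⊤ : Subgroup G).lowerCentralSeries (i + 1) with hZ'
      set K := H ⊔ Z
      have hle : H ⊔ Z' ≤ K := sup_le_sup_left (Subgroup.lowerCentralSeries_antitone _ i.le_succ) H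
      let π := QuotientGroup.mk' Z'
      have hcent : ∀ z ∈ Z, π z ∈ Subgroup.center (G ⧸ Z') := by
        intro z hz
        rw [Subgroup.mem_center_iff]
        intro y
        obtain ⟨y, rfl⟩ := QuotientGroup.mk'_surjective Z' y
        have : ⁅z, y⁆ ∈ Z' := by
          rw [hZ', Subgroup.lowerCentralSeries_succ]
          exact Subgroup.commutator_mem_commutator hz (Subgroup.mem_top y)
        have h1 : π ⁅z, y⁆ = 1 := (QuotientGroup.eq_one_iff _).2 this
        rw [map_commutatorElement, commutatorElement_eq_one_iff_commute] at h1
        exact h1.eq.symm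
      have hcomm : commutator K ≤ (H ⊔ Z').subgroupOf K := by
        rw [commutator_def, Subgroup.commutator_le]
        rintro ⟨g₁, hg₁⟩ - ⟨g₂, hg₂⟩ -
        obtain ⟨a, ha, z, hz, rfl⟩ := Subgroup.mem_sup_of_normal_right.1 hg₁
        obtain ⟨b, hb, y, hy, rfl⟩ := Subgroup.mem_sup_of_normal_right.1 hg₂
        rw [Subgroup.mem_subgroupOf]
        change ⁅a * z, b * y⁆ ∈ H ⊔ Z'
        have h1 : π ⁅a, b⁆ = π ⁅a * z, b * y⁆ := by
          simp only [map_commutatorElement, map_mul,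
            commutatorElement_mul_mul_of_mem_center (hcent z hz) (hcent y hy)]
        refine Subgroup.mem_sup_of_normal_right.2
          ⟨⁅a, b⁆, ?_, _, QuotientGroup.eq.1 h1, mul_inv_cancel_left _ _⟩
        rw [commutatorElement_def]
        exact mul_mem (mul_mem (mul_mem ha hb) (inv_mem ha)) (inv_mem hb)
      have := finiteIndex_of_commutator_le_of_exists_pow_mem hcomm fun g => by
        obtain ⟨k, hk, hg⟩ := h g
        exact ⟨k, hk, Subgroup.mem_sup_left hg⟩
      refine ⟨?_⟩
      rw [← Subgroup.relIndex_mul_index hle]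
      exact mul_ne_zero this.index_ne_zero ih.index_ne_zero
  obtain ⟨n, hn⟩ := Subgroup.nilpotent_iff_lowerCentralSeries.1 ‹Group.IsNilpotent G›
  have := key n
  rwa [hn, sup_bot_eq] at this

/-! ### Residual `p`-group property -/

/-- A finitely generated nilpotent group whose center is a `p`-group is a `p`-group. -/
theorem IsPGroup.of_isPGroup_center {G : Type*} [Group G] [Group.IsNilpotent G] {p : ℕ} :
    Group.FG G → IsPGroup p (Subgroup.center G) → IsPGroup p G := by
  apply Group.nilpotent_center_quotient_ind
    (P := fun G _ _ => Group.FG G → IsPGroup p (Subgroup.center G) → IsPGroup p G) G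
  · intro G _ _ _ _
    exact .of_subsingleton p G
  · intro G _ _ ih hfg hG
    have hc : ∀ z ∈ Subgroup.center G, ∃ k : ℕ, z ^ p ^ k = 1 := fun z hz => by
      obtain ⟨k, hk⟩ := hG ⟨z, hz⟩
      exact ⟨k, congrArg Subtype.val hk⟩
    obtain ⟨S, hS⟩ := hfg.out
    let π := QuotientGroup.mk' (Subgroup.center G)
    have hquot : IsPGroup p (G ⧸ Subgroup.center G) := by
      refine ih inferInstance ?_
      rintro ⟨x, hx⟩
      obtain ⟨x, rfl⟩ := QuotientGroup.mk'_surjective _ x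
      have hxy : ∀ y, ⁅x, y⁆ ∈ Subgroup.center G := by
        intro y
        rw [← QuotientGroup.eq_one_iff]
        change π ⁅x, y⁆ = 1
        rw [map_commutatorElement, commutatorElement_eq_one_iff_commute]
        exact (Subgroup.mem_center_iff.1 hx (π y)).symm
      choose f hf using fun y => hc ⁅x, y⁆ (hxy y)
      -- `p ^ S.sup f` kills the commutators of `x` with all the finitely many generators, so this
      -- power of `x` is central.
      refine ⟨S.sup f, Subtype.ext ?_⟩
      change π x ^ p ^ S.sup f = 1
      rw [← map_pow]
      refine (QuotientGroup.eq_one_iff _).2 ?_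
      have hcent : (⊤ : Subgroup G) ≤ Subgroup.centralizer {x ^ p ^ S.sup f} := by
        rw [← hS, Subgroup.closure_le]
        intro s hs
        rw [SetLike.mem_coe, Subgroup.mem_centralizer_singleton_iff]
        have h1 := pow_mul_eq_of_mul_eq_central (a := x) (b := s) (hxy s)
          (by simp [commutatorElement_def]) (p ^ S.sup f)
        have h2 : ⁅x, s⁆ ^ p ^ S.sup f = 1 := by
          obtain ⟨d, hd⟩ := Nat.pow_dvd_pow p (Finset.le_sup (f := f) hs)
          rw [hd, pow_mul, hf, one_pow]
        rw [h1, h2, one_mul]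
      rw [Subgroup.mem_center_iff]
      intro y
      exact Subgroup.mem_centralizer_singleton_iff.1 (hcent (Subgroup.mem_top y))
    intro g
    obtain ⟨k, hk⟩ := hquot (π g)
    rw [← map_pow] at hk
    obtain ⟨l, hl⟩ := hc _ ((QuotientGroup.eq_one_iff _).1 hk)
    exact ⟨k + l, by rw [pow_add, pow_mul, hl]⟩

/-- A nontrivial normal subgroup of a nilpotent group meets the center nontrivially. -/
theorem Subgroup.Normal.exists_mem_center_of_isNilpotent {G : Type*} [Group G]
    [Group.IsNilpotent G] {H : Subgroup G} (hH : H.Normal) {g : G} (hg : g ∈ H) (hg1 : g ≠ 1) :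
    ∃ z ∈ H, z ∈ Subgroup.center G ∧ z ≠ 1 := by
  classical
  have hex : ∃ n : ℕ, ∃ x ∈ H, x ≠ 1 ∧ x ∈ Subgroup.upperCentralSeries G n := by
    obtain ⟨n, hn⟩ := Group.IsNilpotent.nilpotent G
    exact ⟨n, g, hg, hg1, hn ▸ Subgroup.mem_top g⟩
  -- Take `x ≠ 1` in `H` as low as possible in the upper central series: each `⁅x, y⁆` lies in `H`
  -- and one step lower, so it is trivial.
  obtain ⟨x, hx, hx1, hxn⟩ := Nat.find_spec hex
  refine ⟨x, hx, ?_, hx1⟩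
  rcases hn : Nat.find hex with _ | n
  · rw [hn, Subgroup.upperCentralSeries_zero, Subgroup.mem_bot] at hxn
    exact absurd hxn hx1
  · rw [hn, Subgroup.mem_upperCentralSeries_succ_iff] at hxn
    have hmin := Nat.find_min hex (m := n) (by omega)
    push Not at hmin
    rw [Subgroup.mem_center_iff]
    intro y
    have hxy : ⁅x, y⁆ ∈ H := by
      rw [commutatorElement_def, mul_assoc, mul_assoc, ← mul_assoc y]
      exact mul_mem hx (hH.conj_mem _ (inv_mem hx) y)
    by_contra hne
    refine hmin _ hxy ?_ (hxn y)
    rw [Ne, commutatorElement_eq_one_iff_mul_comm]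
    exact fun h => hne h.symm

/-- A finitely generated torsion-free nilpotent group is residually a `p`-group for every
prime `p`. -/
theorem exists_isPGroup_quotient_notMem {G : Type*} [Group G] [Group.FG G] [Group.IsNilpotent G]
    (htf : ∀ g : G, IsOfFinOrder g → g = 1) {p : ℕ} (hp : p.Prime) {g : G} (hg : g ≠ 1) :
    ∃ (K : Subgroup G) (_ : K.Normal), IsPGroup p (G ⧸ K) ∧ g ∉ K := by
  obtain ⟨z, hzg, hzc, hz1⟩ :=
    (Subgroup.normalClosure_normal (s := {g})).exists_mem_center_of_isNilpotent
      (Subgroup.subset_normalClosure (Set.mem_singleton g)) hg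
  suffices h : ∃ (K : Subgroup G) (_ : K.Normal), IsPGroup p (G ⧸ K) ∧ z ∉ K by
    obtain ⟨K, hK, hp, hz⟩ := h
    refine ⟨K, hK, hp, fun hgK => hz ?_⟩
    exact Subgroup.normalClosure_le_normal (Set.singleton_subset_iff.2 hgK) hzg
  have normal_zpowers : ∀ {Q : Type _} [Group Q] {c : Q}, c ∈ Subgroup.center Q →
      (Subgroup.zpowers c).Normal := by
    intro Q _ c hc
    refine ⟨fun n hn y => ?_⟩
    have : n ∈ Subgroup.center Q := (Subgroup.zpowers_le.2 hc) hn
    rwa [Subgroup.mem_center_iff.1 this, mul_inv_cancel_right]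
  have hzp : z ∉ Subgroup.zpowers (z ^ p) := by
    rintro ⟨j, hj⟩
    refine hz1 (htf z (isOfFinOrder_iff_zpow_eq_one.2 ⟨p * j - 1, ?_, ?_⟩))
    · intro h
      have : (p : ℤ) ∣ 1 := ⟨j, by omega⟩
      exact hp.one_lt.ne' (by exact_mod_cast Int.eq_one_of_dvd_one (by positivity) this)
    · have hj' : z ^ ((p : ℤ) * j) = z := by rw [zpow_mul, zpow_natCast]; exact hj
      rw [zpow_sub, hj', zpow_one, mul_inv_cancel]
  -- Choose `K` maximal among normal subgroups avoiding `z`, above `⟨z ^ p⟩`. Then the image of `z`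
  -- has order `p` and lies in every nontrivial central cyclic subgroup of `G ⧸ K`, which forces the
  -- center to be a `p`-group.
  obtain ⟨K, hWK, hK⟩ := zorn_le_nonempty₀ {K : Subgroup G | K.Normal ∧ z ∉ K} (by
    intro c hc hchain K₀ hK₀
    have hmem : ∀ {x}, x ∈ sSup c ↔ ∃ K ∈ c, x ∈ K :=
      Subgroup.mem_sSup_of_directedOn ⟨K₀, hK₀⟩ hchain.directedOn
    refine ⟨sSup c, ⟨⟨fun n hn y => ?_⟩, fun hz => ?_⟩, fun K hK => le_sSup hK⟩
    · obtain ⟨K, hK, hn⟩ := hmem.1 hn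
      exact hmem.2 ⟨K, hK, (hc hK).1.conj_mem n hn y⟩
    · obtain ⟨K, hK, hz⟩ := hmem.1 hz
      exact (hc hK).2 hz) (Subgroup.zpowers (z ^ p)) ⟨normal_zpowers (pow_mem hzc p), hzp⟩
  have hKn := hK.prop.1
  refine ⟨K, hKn, IsPGroup.of_isPGroup_center inferInstance ?_, hK.prop.2⟩
  let π := QuotientGroup.mk' K
  have hζ1 : π z ≠ 1 := fun h => hK.prop.2 ((QuotientGroup.eq_one_iff _).1 h)
  have hζp : π z ^ p = 1 := by
    rw [← map_pow]
    exact (QuotientGroup.eq_one_iff _).2 (hWK (Subgroup.mem_zpowers _))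
  have hmono : ∀ c ∈ Subgroup.center (G ⧸ K), c ≠ 1 → π z ∈ Subgroup.zpowers c := by
    intro c hc hc1
    have := normal_zpowers hc
    by_contra hz
    have hle : K ≤ (Subgroup.zpowers c).comap π := fun x hx => by
      rw [Subgroup.mem_comap, show π x = 1 from (QuotientGroup.eq_one_iff x).2 hx]
      exact one_mem _
    have hle' := hK.le_of_ge ⟨inferInstance, hz⟩ hle
    obtain ⟨x, rfl⟩ := QuotientGroup.mk'_surjective K c
    exact hc1 ((QuotientGroup.eq_one_iff x).2 (hle' (Subgroup.mem_zpowers _)))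
  rintro ⟨c, hc⟩
  by_cases hc1 : c = 1
  · exact ⟨0, by simp [hc1]⟩
  have hfin : IsOfFinOrder c := by
    obtain ⟨i, hi⟩ := hmono c hc hc1
    refine isOfFinOrder_iff_zpow_eq_one.2 ⟨i * p, mul_ne_zero ?_ (by exact_mod_cast hp.ne_zero), ?_⟩
    · rintro rfl
      exact hζ1 (by rw [← hi]; exact zpow_zero c)
    · rw [zpow_mul, zpow_natCast, ← hζp, ← hi]
  -- If the prime-to-`p` part `m` of the order survived, `π z` would be a power of `c ^ p ^ a`,
  -- hence killed by both `m` and `p`.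
  obtain ⟨a, m, hm, hord⟩ := Nat.exists_eq_pow_mul_and_not_dvd hfin.orderOf_pos.ne' p hp.ne_one
  refine ⟨a, Subtype.ext ?_⟩
  change c ^ p ^ a = 1
  by_contra hne
  obtain ⟨i, hi⟩ := hmono _ (pow_mem hc (p ^ a)) hne
  have hζm : π z ^ m = 1 := by
    rw [← hi]
    change ((c ^ p ^ a) ^ i) ^ m = 1
    rw [← zpow_natCast, ← zpow_mul, mul_comm, zpow_mul, zpow_natCast, ← pow_mul, ← hord,
      pow_orderOf_eq_one, one_zpow]
  have := pow_gcd_eq_one.2 ⟨hζm, hζp⟩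
  rw [((Nat.Prime.coprime_iff_not_dvd hp).2 hm).symm, pow_one] at this
  exact hζ1 this

/-! ### Existence of the completion -/

/-- A quotient of `G` that is a `p`-group for some prime `p`. -/
structure PGroupQuotient (G : Type u) [Group G] where
  prime : ℕ
  isPrime : prime.Prime
  ker : Subgroup G
  normal : ker.Normal
  isPGroup : IsPGroup prime (G ⧸ ker)

namespace PGroupQuotient

variable (G : Type u) [Group G]

instance (i : PGroupQuotient G) : i.ker.Normal := i.normal

/-- The families that are trivial at all sufficiently large primes. -/
def eventuallyTrivial : Subgroup (∀ i : PGroupQuotient G, G ⧸ i.ker) where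
  carrier := {f | ∃ n : ℕ, ∀ i, n < i.prime → f i = 1}
  one_mem' := ⟨0, fun _ _ => rfl⟩
  mul_mem' := by
    rintro f g ⟨m, hf⟩ ⟨n, hg⟩
    refine ⟨max m n, fun i hi => ?_⟩
    rw [Pi.mul_apply, hf i (lt_of_le_of_lt (le_max_left m n) hi),
      hg i (lt_of_le_of_lt (le_max_right m n) hi), mul_one]
  inv_mem' := by
    rintro f ⟨m, hf⟩
    exact ⟨m, fun i hi => by rw [Pi.inv_apply, hf i hi, inv_one]⟩

instance : (eventuallyTrivial G).Normal where
  conj_mem := by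
    rintro f ⟨m, hf⟩ g
    refine ⟨m, fun i hi => ?_⟩
    rw [Pi.mul_apply, Pi.mul_apply, hf i hi, mul_one, Pi.inv_apply, mul_inv_cancel]

/-- The product of all quotients of `G` that are `p`-groups for some prime `p`, reduced
modulo the families that are trivial at all large primes. -/
abbrev ReducedProduct : Type u :=
  (∀ i : PGroupQuotient G, G ⧸ i.ker) ⧸ eventuallyTrivial G

instance [Group.IsNilpotent G] : Group.IsNilpotent (ReducedProduct G) :=
  have : Group.IsNilpotent (∀ i : PGroupQuotient G, G ⧸ i.ker) :=
    Group.isNilpotent_pi_of_bounded_class (Group.nilpotencyClass G)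
      fun i => Group.nilpotencyClass_quotient_le i.ker
  inferInstance

variable {G}

theorem coprime_of_lt (i : PGroupQuotient G) {k : ℕ} (hk : 0 < k) (h : k < i.prime) :
    i.prime.Coprime k :=
  Nat.coprime_of_lt_prime hk.ne' h i.isPrime

/-- At primes above `k` the power map is bijective on each factor; the remaining primes are
invisible in the quotient. -/
theorem pow_bijective {k : ℕ} (hk : 0 < k) :
    Function.Bijective fun x : ReducedProduct G => x ^ k := by
  constructor
  · intro x y hxy
    induction x using QuotientGroup.induction_on with
    | H f =>
    induction y using QuotientGroup.induction_on with
    | H g =>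
    obtain ⟨n, hn⟩ := QuotientGroup.eq.1
      (show ((f ^ k : ∀ i, _) : ReducedProduct G) = (g ^ k : ∀ i, _) from hxy)
    refine QuotientGroup.eq.2 ⟨max n k, fun i hi => ?_⟩
    have h1 := hn i (lt_of_le_of_lt (le_max_left n k) hi)
    have hco := i.coprime_of_lt hk (lt_of_le_of_lt (le_max_right n k) hi)
    have h2 : f i ^ k = g i ^ k := inv_mul_eq_one.1 h1
    exact inv_mul_eq_one.2 ((i.isPGroup.powEquiv hco).injective h2)
  · intro x
    induction x using QuotientGroup.induction_on with
    | H f =>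
    have hroot : ∀ i : PGroupQuotient G, ∃ y : G ⧸ i.ker, k < i.prime → y ^ k = f i := by
      intro i
      by_cases h : k < i.prime
      · obtain ⟨y, hy⟩ := (i.isPGroup.powEquiv (i.coprime_of_lt hk h)).surjective (f i)
        exact ⟨y, fun _ => hy⟩
      · exact ⟨1, fun h' => absurd h' h⟩
    choose g hg using hroot
    refine ⟨(g : ReducedProduct G), ?_⟩
    change ((g ^ k : ∀ i, _) : ReducedProduct G) = f
    exact QuotientGroup.eq.2 ⟨k, fun i hi => inv_mul_eq_one.2 (hg i hi)⟩

variable (G) in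
/-- The diagonal homomorphism. -/
def diagonal : G →* ReducedProduct G :=
  (QuotientGroup.mk' (eventuallyTrivial G)).comp
    (MonoidHom.pi fun i : PGroupQuotient G => QuotientGroup.mk' i.ker)

/-- A nontrivial element survives in `p`-quotients for arbitrarily large `p`. -/
theorem diagonal_injective [Group.FG G] [Group.IsNilpotent G] (htf : TorsionFreeGroup G) :
    Function.Injective (diagonal G) := by
  rw [injective_iff_map_eq_one]
  intro g hg
  by_contra hg1
  obtain ⟨n, hn⟩ := (QuotientGroup.eq_one_iff _).1 hg
  obtain ⟨p, hnp, hp⟩ := Nat.exists_infinite_primes (n + 1)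
  obtain ⟨K, hK, hKp, hgK⟩ := exists_isPGroup_quotient_notMem htf hp hg1
  exact hgK ((QuotientGroup.eq_one_iff g).1 (hn ⟨p, hp, K, hK, hKp⟩ hnp))

end PGroupQuotient

theorem isRationalCompletion_isolator {N : Type u} {U : Type v} [Group N] [Group U]
    [Group.IsNilpotent U] (hU : ∀ k : ℕ, 0 < k → Function.Bijective fun x : U => x ^ k)
    {φ : N →* U} (hφ : Function.Injective φ) :
    IsRationalCompletion (φ.codRestrict φ.range.isolator
      fun n => φ.range.le_isolator ⟨n, rfl⟩) where
  torsionFree := by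
    intro x hx
    obtain ⟨k, hk, h⟩ := isOfFinOrder_iff_pow_eq_one.1 hx
    refine Subtype.ext ((hU k hk).injective ?_)
    change (x : U) ^ k = 1 ^ k
    rw [one_pow, ← SubgroupClass.coe_pow, h, OneMemClass.coe_one]
  nilpotent := inferInstance
  injective := fun x y h => hφ (congrArg Subtype.val h)
  existsUnique_root := by
    intro n k hk
    obtain ⟨x, hx⟩ := (hU k hk).surjective (φ n)
    have hx' : x ^ k = φ n := hx
    refine ⟨⟨x, k, hk, n, hx'.symm⟩, Subtype.ext hx', fun y hy => Subtype.ext ?_⟩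
    exact (hU k hk).injective ((congrArg Subtype.val hy).trans hx'.symm)
  exists_pow_mem := by
    rintro ⟨x, k, hk, n, hn⟩
    exact ⟨k, hk, n, Subtype.ext hn⟩

/-- A finitely generated torsion-free nilpotent group has a rational Malcev completion. -/
theorem exists_isRationalCompletion {N : Type u} [Group N] [Group.FG N] [Group.IsNilpotent N]
    (htf : TorsionFreeGroup N) :
    ∃ (M : Type u) (_ : Group M) (ι : N →* M), IsRationalCompletion ι :=
  ⟨_, _, _, isRationalCompletion_isolator (fun _ => PGroupQuotient.pow_bijective)
    (PGroupQuotient.diagonal_injective htf)⟩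

/-! ### Roots in the completion -/

namespace IsRationalCompletion

variable {N : Type u} {M : Type v} [Group N] [Group M] {ι : N →* M}

/-- The definition gives unique roots only for elements of `N`; a further power `l` moves `x ^ k`
into `N`. -/
theorem pow_left_injective (h : IsRationalCompletion ι) {k : ℕ} (hk : 0 < k) :
    Function.Injective fun x : M => x ^ k := by
  intro x y hxy
  obtain ⟨l, hl, n, hn⟩ := h.exists_pow_mem (x ^ k)
  have hxy' : x ^ k = y ^ k := hxy
  exact (h.existsUnique_root n (k * l) (Nat.mul_pos hk hl)).unique
    (by rw [hn, pow_mul]) (by rw [hn, pow_mul, hxy'])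

theorem eq_one_of_pow_eq_one (h : IsRationalCompletion ι) {k : ℕ} (hk : 0 < k) {x : M}
    (hx : x ^ k = 1) : x = 1 :=
  h.torsionFree x (isOfFinOrder_iff_pow_eq_one.2 ⟨k, hk, hx⟩)

/-- The conjugate of `x` by `y` has the same `k`-th power as `x`. -/
theorem commute_of_commute_pow_left (h : IsRationalCompletion ι) {k : ℕ} (hk : 0 < k) {x y : M}
    (hxy : Commute (x ^ k) y) : Commute x y := by
  have : y * x * y⁻¹ = x := h.pow_left_injective hk <| by
    change (y * x * y⁻¹) ^ k = x ^ k
    rw [conj_pow, ← hxy.eq, mul_inv_cancel_right]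
  exact (mul_inv_eq_iff_eq_mul.1 this).symm

theorem comp_subtype (h : IsRationalCompletion ι) (H : Subgroup N) [H.FiniteIndex] :
    IsRationalCompletion (ι.comp H.subtype) where
  torsionFree := h.torsionFree
  nilpotent := h.nilpotent
  injective := h.injective.comp H.subtype_injective
  existsUnique_root n k hk := h.existsUnique_root n k hk
  exists_pow_mem := by
    intro m
    obtain ⟨k, hk, n, hn⟩ := h.exists_pow_mem m
    obtain ⟨l, hl, -, hnl⟩ :=
      Subgroup.exists_pow_mem_of_index_ne_zero Subgroup.FiniteIndex.index_ne_zero (H := H) n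
    exact ⟨k * l, Nat.mul_pos hk hl, ⟨n ^ l, hnl⟩, by rw [pow_mul, ← hn, ← map_pow]; rfl⟩

end IsRationalCompletion

/-! ### Transfer of direct decompositions -/

theorem IsRationalCompletion.directlyIndecomposable_source {N M : Type u} [Group N] [Group M]
    {ι : N →* M} (h : IsRationalCompletion ι) (hM : DirectlyIndecomposable M) :
    DirectlyIndecomposable N := by
  rintro A B _ _ ⟨e⟩
  have := h.nilpotent
  let f : A →* M := (ι.comp e.symm.toMonoidHom).comp (MonoidHom.inl A B)
  let g : B →* M := (ι.comp e.symm.toMonoidHom).comp (MonoidHom.inr A B)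
  have hf : Function.Injective f :=
    (h.injective.comp e.symm.injective).comp fun x y hxy => (Prod.ext_iff.1 hxy).1
  have hg : Function.Injective g :=
    (h.injective.comp e.symm.injective).comp fun x y hxy => (Prod.ext_iff.1 hxy).2
  have hfg : ∀ a b, f a * g b = ι (e.symm (a, b)) := by
    intro a b
    change ι (e.symm (a, 1)) * ι (e.symm (1, b)) = _
    rw [← map_mul, ← map_mul, Prod.mk_mul_mk, mul_one, one_mul]
  have hgf : ∀ a b, g b * f a = ι (e.symm (a, b)) := by
    intro a b
    change ι (e.symm (1, b)) * ι (e.symm (a, 1)) = _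
    rw [← map_mul, ← map_mul, Prod.mk_mul_mk, mul_one, one_mul]
  have hcomm : ∀ (x : f.range.isolator) (y : g.range.isolator),
      Commute (f.range.isolator.subtype x) (g.range.isolator.subtype y) := by
    rintro ⟨x, k, hk, a, ha⟩ ⟨y, l, hl, b, hb⟩
    refine h.commute_of_commute_pow_left hk (h.commute_of_commute_pow_left hl ?_).symm
    change Commute (y ^ l) (x ^ k)
    rw [← ha, ← hb]
    exact (hgf a b).trans (hfg a b).symm
  have hbij : Function.Bijective (MonoidHom.noncommCoprod _ _ hcomm) := by
    constructor
    · rw [MonoidHom.noncommCoprod_injective]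
      refine ⟨Subgroup.subtype_injective _, Subgroup.subtype_injective _, ?_⟩
      rw [Subgroup.range_subtype, Subgroup.range_subtype, Subgroup.disjoint_def]
      rintro x ⟨k, hk, a, ha⟩ ⟨l, hl, b, hb⟩
      have h1 : f (a ^ l) = g (b ^ k) := by
        rw [map_pow, map_pow, ha, hb, ← pow_mul, ← pow_mul, mul_comm]
      have h2 : a ^ l = 1 := (Prod.ext_iff.1 (e.symm.injective (h.injective h1))).1
      refine h.eq_one_of_pow_eq_one (Nat.mul_pos hk hl) ?_
      rw [pow_mul, ← ha, ← map_pow, h2, map_one]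
    · intro m
      obtain ⟨k, hk, n, hn⟩ := h.exists_pow_mem m
      -- The `k`-th roots of the two components of `n = m ^ k` commute, so their product is a `k`-th
      -- root of `m ^ k`, hence `m`.
      obtain ⟨x, hx, -⟩ := h.existsUnique_root (e.symm ((e n).1, 1)) k hk
      obtain ⟨y, hy, -⟩ := h.existsUnique_root (e.symm (1, (e n).2)) k hk
      let x' : f.range.isolator := ⟨x, k, hk, (e n).1, hx.symm⟩
      let y' : g.range.isolator := ⟨y, k, hk, (e n).2, hy.symm⟩
      refine ⟨(x', y'), h.pow_left_injective hk ?_⟩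
      change (x * y) ^ k = m ^ k
      have hxy : Commute x y := hcomm x' y'
      rw [hxy.mul_pow, hx, hy, ← hn]
      exact (hfg _ _).trans (by rw [Prod.mk.eta, e.symm_apply_apply])
  refine (hM _ _ ⟨(MulEquiv.ofBijective _ hbij).symm⟩).imp ?_ ?_ <;> intro hs
  · refine ⟨fun x y => hf ?_⟩
    exact congrArg Subtype.val (Subsingleton.elim
      (⟨f x, f.range.le_isolator ⟨x, rfl⟩⟩ : f.range.isolator) ⟨f y, f.range.le_isolator ⟨y, rfl⟩⟩)
  · refine ⟨fun x y => hg ?_⟩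
    exact congrArg Subtype.val (Subsingleton.elim
      (⟨g x, g.range.le_isolator ⟨x, rfl⟩⟩ : g.range.isolator) ⟨g y, g.range.le_isolator ⟨y, rfl⟩⟩)

theorem IsRationalCompletion.directlyIndecomposable_target {N M : Type u} [Group N] [Group M]
    [Group.FG N] [Group.IsNilpotent N] {ι : N →* M} (h : IsRationalCompletion ι)
    (hN : ∀ H : Subgroup N, H.FiniteIndex → DirectlyIndecomposable H) :
    DirectlyIndecomposable M := by
  rintro A B _ _ ⟨e⟩
  let φ : N →* A × B := e.toMonoidHom.comp ι
  have hφ : Function.Injective φ := e.injective.comp h.injective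
  have hpow : ∀ x : A × B, ∃ k : ℕ, 0 < k ∧ ∃ n, φ n = x ^ k := by
    intro x
    obtain ⟨k, hk, n, hn⟩ := h.exists_pow_mem (e.symm x)
    refine ⟨k, hk, n, ?_⟩
    change e (ι n) = _
    rw [hn, map_pow, e.apply_symm_apply]
  -- `N₁` and `N₂` are the intersections of `N` with the factors `A` and `B`.
  let N₁ : Subgroup N := ((MonoidHom.snd A B).comp φ).ker
  let N₂ : Subgroup N := ((MonoidHom.fst A B).comp φ).ker
  have h₁ : ∀ n, n ∈ N₁ ↔ (φ n).2 = 1 := fun n => Iff.rfl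
  have h₂ : ∀ n, n ∈ N₂ ↔ (φ n).1 = 1 := fun n => Iff.rfl
  have hcomm : ∀ (x : N₁) (y : N₂), Commute (N₁.subtype x) (N₂.subtype y) := by
    rintro ⟨x, hx⟩ ⟨y, hy⟩
    refine hφ ?_
    change φ (x * y) = φ (y * x)
    rw [map_mul, map_mul]
    rw [h₁] at hx
    rw [h₂] at hy
    ext <;> simp [hx, hy]
  let ψ := MonoidHom.noncommCoprod _ _ hcomm
  have hψ : Function.Injective ψ := by
    rw [MonoidHom.noncommCoprod_injective]
    refine ⟨Subgroup.subtype_injective _, Subgroup.subtype_injective _, ?_⟩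
    rw [Subgroup.range_subtype, Subgroup.range_subtype, Subgroup.disjoint_def]
    intro x hx hy
    refine hφ ?_
    rw [map_one]
    exact Prod.ext ((h₂ x).1 hy) ((h₁ x).1 hx)
  have hfin : ψ.range.FiniteIndex := by
    refine finiteIndex_of_exists_pow_mem _ fun n => ?_
    obtain ⟨k, hk, x, hx⟩ := hpow ((φ n).1, 1)
    obtain ⟨l, hl, y, hy⟩ := hpow (1, (φ n).2)
    have hx₁ : x ∈ N₁ := by rw [h₁, hx]; simp
    have hy₂ : y ∈ N₂ := by rw [h₂, hy]; simp
    -- The exponents `l` and `k` bring both components to the common power `k * l`.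
    refine ⟨k * l, Nat.mul_pos hk hl, (⟨x ^ l, pow_mem hx₁ l⟩, ⟨y ^ k, pow_mem hy₂ k⟩), hφ ?_⟩
    change φ (x ^ l * y ^ k) = _
    rw [map_mul, map_pow, map_pow, map_pow, hx, hy]
    ext
    · simp [pow_mul]
    · simp [mul_comm k l, pow_mul]
  refine (hN ψ.range hfin N₁ N₂ ⟨(MonoidHom.ofInjective hψ).symm⟩).imp ?_ ?_ <;> intro hs
  · refine subsingleton_of_forall_eq 1 fun a => ?_
    obtain ⟨k, hk, n, hn⟩ := hpow (a, 1)
    have hn₁ : n ∈ N₁ := by rw [h₁, hn]; simp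
    have hn1 : n = 1 := congrArg Subtype.val (Subsingleton.elim (⟨n, hn₁⟩ : N₁) 1)
    have := h.eq_one_of_pow_eq_one hk (x := e.symm (a, 1)) (by
      rw [← map_pow, ← hn, hn1, map_one, map_one])
    rw [map_eq_one_iff _ e.symm.injective] at this
    exact (Prod.ext_iff.1 this).1
  · refine subsingleton_of_forall_eq 1 fun b => ?_
    obtain ⟨k, hk, n, hn⟩ := hpow (1, b)
    have hn₂ : n ∈ N₂ := by rw [h₂, hn]; simp
    have hn1 : n = 1 := congrArg Subtype.val (Subsingleton.elim (⟨n, hn₂⟩ : N₂) 1)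
    have := h.eq_one_of_pow_eq_one hk (x := e.symm (1, b)) (by
      rw [← map_pow, ← hn, hn1, map_one, map_one])
    rw [map_eq_one_iff _ e.symm.injective] at this
    exact (Prod.ext_iff.1 this).2

theorem mainTheorem9 (N : Type u) [Group N] (hfg : Group.FG N)
    (htf : TorsionFreeGroup N) (hnil : Group.IsNilpotent N) :
    (RationallyIndecomposable N ↔
      ∀ H : Subgroup N, H.FiniteIndex → DirectlyIndecomposable H) ∧
    (RationallyIndecomposable N →
      ∀ H : Subgroup N, H.FiniteIndex → RationallyIndecomposable H) := by
  refine ⟨⟨?_, fun hN => ?_⟩, ?_⟩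
  · rintro ⟨M, _, ι, hι, hM⟩ H _
    exact (hι.comp_subtype H).directlyIndecomposable_source hM
  · obtain ⟨M, _, ι, hι⟩ := exists_isRationalCompletion htf
    exact ⟨M, _, ι, hι, hι.directlyIndecomposable_target hN⟩
  · rintro ⟨M, _, ι, hι, hM⟩ H _
    exact ⟨M, _, ι.comp H.subtype, hι.comp_subtype H, hM⟩
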